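/- For integers $k\ge 1$ and $n\ge 0$ let $T_{\pm 3^{k}(3^{k+1})}(n)$ denote the number of partition triples of $n$ (ordered triples $(\pi_1,\pi_2,\pi_3)$ of integer partitions, possibly empty, whose sizes add up to $n$) in which no part is congruent to $3^k$ or $-3^k$ modulo $3^{k+1}$. Then for all integers $n,\alpha,\beta\ge 0$: \[ T_{\pm3^{2\alpha+2}(3^{2\alpha+3})}\left(3^{2\alpha+2\beta+2}n+\frac{5\cdot3^{2\alpha+2\beta+2}+2\cdot3^{2\alpha+2}+1}{8}\right)\equiv 0 \pmod{3^{3\alpha+3\beta+4}}, \] \[ T_{\pm3^{2\alpha+2}(3^{2\alpha+3})}\left(3^{2\alpha+2\beta+3}n+\frac{13\cdot3^{2\alpha+2\beta+2}+2\cdot3^{2\alpha+2}+1}{8}\right)\equiv 0 \pmod{3^{3\alpha+3\beta+5}}, \] \[ T_{\pm3^{2\alpha+2}(3^{2\alpha+3})}\left(3^{2\alpha+2\beta+3}n+\frac{7\cdot3^{2\alpha+2\beta+3}+2\cdot3^{2\alpha+2}+1}{8}\right)\equiv 0 \pmod{3^{3\alpha+3\beta+6}}. \] -/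

import Mathlib

/-- The finite set of all partition triples `(π₁, π₂, π₃)` of `n` none of whose parts satisfies
`bad`. Its elements are pairs `⟨m, π⟩` where `m 0 + m 1 + m 2 = n` and `π i` is a partition of
`m i` all of whose parts fail `bad`; triples are ordered and components may be empty.
(With `bad p := ℓ ∣ p` these are the `ℓ`-regular partition triples of `n`.) -/
def partitionTriplesAvoiding (bad : ℕ → Prop) [DecidablePred bad] (n : ℕ) :
    Finset (Σ m : Fin 3 → ℕ, (i : Fin 3) → (m i).Partition) :=
  (Finset.piAntidiag Finset.univ n).sigma fun m =>
    Fintype.piFinset fun i => Nat.Partition.restricted (m i) fun p => ¬ bad p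

/-- `p ≡ 3 ^ k` or `p ≡ -3 ^ k` modulo `3 ^ (k + 1)`. -/
def IsPMThreePow (k p : ℕ) : Prop :=
  (p : ℤ) ≡ 3 ^ k [ZMOD 3 ^ (k + 1)] ∨ (p : ℤ) ≡ -3 ^ k [ZMOD 3 ^ (k + 1)]

instance (k : ℕ) : DecidablePred (IsPMThreePow k) := fun p =>
  inferInstanceAs (Decidable
    ((p : ℤ) ≡ 3 ^ k [ZMOD 3 ^ (k + 1)] ∨ (p : ℤ) ≡ -3 ^ k [ZMOD 3 ^ (k + 1)]))

/-- `T_{±3^k (3^{k+1})}(n)`: the number of partition triples of `n` in which no part is congruent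
to `±3 ^ k` modulo `3 ^ (k + 1)`. Its generating function is
`E(q^(3^k))^3 / (E(q)^3 E(q^(3^(k+1)))^3)`. -/
def tripleCount (k n : ℕ) : ℕ :=
  (partitionTriplesAvoiding (IsPMThreePow k) n).card

/-! Write E(q) for the Euler product, U for the operator keeping the exponents divisible by 3 (and
dividing them by 3), ζ = q E(q^9)^3/E(q)^3 (`quotNine`) and Z = q E(q^3)^12/E(q)^12 (`quotThree`).
The generating function is r(q^(3^k))/E(q)^3 with r = E(q)^3/E(q^3)^3, and a factor g(q^3) passes
through U as g(q). So successive sections only involve U applied to series in ζ and Z.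

Jacobi's identity gives E(q)^3 = x - y, where x is a series in q^3 and y = 3q E(q^9)^3. Multiplying
over the substitutions q ↦ wq, with w^3 = 1, evaluates x^3 - y^3. Hence 1/E^3 is dissected, U(ζ) and
U(ζ^2) are computed, and ζ satisfies a cubic equation over Z(q^3) (`quotNine_pow_three`). With ζ^4 =
Z(q) Z(q^3), this shows that on series Z·P(27Z), P an integer polynomial, U gains a factor 9, and
multiplication by ζ followed by U gains a factor 3 (`section3_quotPoly`,
`section3_quotPoly_mul_quotNine`).

The residues 1 and 2 are extracted alternately, gaining 3^3 every two sections. There are 2α+2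
sections until r is reached, where r/E^3 becomes 1/E(q^3)^3, and then 2β more. This gives the first
congruence. One more section at residue 2 gains 9 and gives the third; the second holds because
modulo the next power of 3 the series is supported on exponents divisible by 3. -/

open PowerSeries
open Finset.HasAntidiagonal (antidiagonal)

/-! ### The finite q-binomial theorem and a finite Jacobi identity -/

/-- A division-free form of the finite `q`-binomial theorem: `iq m` plays the role of
`1 / ((1 - q) ⋯ (1 - q ^ m))`. -/
theorem q_binomial {S : Type*} [CommRing S] (q : S) (iq : ℕ → S) (h0 : iq 0 = 1)
    (hs : ∀ a, iq a = iq (a + 1) * (1 - q ^ (a + 1)))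
    (hu : ∀ a : ℕ, IsUnit (1 - q ^ (a + 1))) (y : S) (N : ℕ) (z : S) :
    iq N * ∏ i ∈ Finset.range N, (y + z * q ^ i) =
      ∑ p ∈ antidiagonal N, q ^ p.1.choose 2 * iq p.1 * iq p.2 * z ^ p.1 * y ^ p.2 := by
  induction N generalizing z with
  | zero => simp [h0]
  | succ N ih =>
    rw [Finset.prod_range_succ']
    have h1 : ∏ k ∈ Finset.range N, (y + z * q ^ (k + 1)) =
        ∏ k ∈ Finset.range N, (y + (z * q) * q ^ k) :=
      Finset.prod_congr rfl fun k _ => by ring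
    have h2 := ih (z * q)
    rw [hs N] at h2
    have key : ∑ p ∈ antidiagonal (N + 1),
          q ^ p.1.choose 2 * iq p.1 * iq p.2 * z ^ p.1 * y ^ p.2 * (1 - q ^ (N + 1)) =
        (y + z) * ∑ p ∈ antidiagonal N,
          q ^ p.1.choose 2 * iq p.1 * iq p.2 * (z * q) ^ p.1 * y ^ p.2 := by
      -- With a + b = N + 1, split 1 - q^(a+b) = q^a (1 - q^b) + (1 - q^a); the two halves yield the
      -- y and z terms.
      have e1 : ∀ p ∈ antidiagonal (N + 1),
          q ^ p.1.choose 2 * iq p.1 * iq p.2 * z ^ p.1 * y ^ p.2 * (1 - q ^ (N + 1)) =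
          q ^ p.1.choose 2 * iq p.1 * iq p.2 * z ^ p.1 * y ^ p.2 * (q ^ p.1 * (1 - q ^ p.2)) +
          q ^ p.1.choose 2 * iq p.1 * iq p.2 * z ^ p.1 * y ^ p.2 * (1 - q ^ p.1) := by
        intro p hp
        rw [← Finset.HasAntidiagonal.mem_antidiagonal.1 hp]
        ring
      rw [Finset.sum_congr rfl e1, Finset.sum_add_distrib, Finset.Nat.sum_antidiagonal_succ',
        Finset.Nat.sum_antidiagonal_succ, add_mul, Finset.mul_sum, Finset.mul_sum]
      simp only [pow_zero, sub_self, mul_zero, zero_add]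
      congr 1
      · refine Finset.sum_congr rfl fun p _ => ?_
        rw [hs p.2]
        ring
      · refine Finset.sum_congr rfl fun p _ => ?_
        rw [hs p.1, Nat.choose_succ_succ' p.1 1, Nat.choose_one_right]
        ring
    refine (hu N).mul_right_cancel ?_
    rw [Finset.sum_mul, key, ← h2, h1]
    ring

theorem two_mul_choose_two (k : ℕ) : 2 * (k + 1).choose 2 = k * (k + 1) := by
  rw [Nat.choose_two_right, Nat.add_sub_cancel, mul_comm (k + 1),
    Nat.two_mul_div_two_of_even (Nat.even_mul_succ_self k)]

/-- The finite product `(1 - X) ⋯ (1 - X ^ m)`. -/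
noncomputable def qFactorial (m : ℕ) : ℤ⟦X⟧ := ∏ i ∈ Finset.range m, (1 - X ^ (i + 1))

theorem isUnit_one_sub_X_pow (a : ℕ) : IsUnit (1 - X ^ (a + 1) : ℤ⟦X⟧) := by
  rw [PowerSeries.isUnit_iff_constantCoeff]
  simp

theorem isUnit_qFactorial (m : ℕ) : IsUnit (qFactorial m) := by
  rw [PowerSeries.isUnit_iff_constantCoeff]
  simp [qFactorial, map_prod]

/-- The inverse of `qFactorial m`. -/
noncomputable def qFactorialInv (m : ℕ) : ℤ⟦X⟧ := ((isUnit_qFactorial m).unit⁻¹ : ℤ⟦X⟧ˣ)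

theorem qFactorialInv_mul (m : ℕ) : qFactorialInv m * qFactorial m = 1 :=
  (isUnit_qFactorial m).val_inv_mul

theorem qFactorial_succ (m : ℕ) : qFactorial (m + 1) = qFactorial m * (1 - X ^ (m + 1)) :=
  Finset.prod_range_succ _ _

theorem qFactorialInv_eq (m : ℕ) :
    qFactorialInv m = qFactorialInv (m + 1) * (1 - X ^ (m + 1)) := by
  refine (isUnit_qFactorial m).mul_right_cancel ?_
  have h := qFactorialInv_mul (m + 1)
  rw [qFactorial_succ] at h
  rw [qFactorialInv_mul]
  linear_combination -h

theorem prod_range_pow_sub_pow (n : ℕ) :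
    ∏ i ∈ Finset.range n, ((X : ℤ⟦X⟧) ^ n - X ^ i) =
      (-1) ^ n * X ^ n.choose 2 * qFactorial n := by
  have h1 : ∀ i ∈ Finset.range n, ((X : ℤ⟦X⟧) ^ n - X ^ i) =
      (-1) * X ^ i * (1 - X ^ (n - 1 - i + 1)) := by
    intro i hi
    have : n = i + (n - 1 - i + 1) := by have := Finset.mem_range.1 hi; omega
    conv_lhs => rw [this, pow_add]
    ring
  rw [Finset.prod_congr rfl h1, Finset.prod_mul_distrib, Finset.prod_mul_distrib,
    Finset.prod_const, Finset.card_range, Finset.prod_pow_eq_pow_sum, Finset.sum_range_id,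
    ← Nat.choose_two_right, Finset.prod_range_reflect (fun i => (1 : ℤ⟦X⟧) - X ^ (i + 1)) n]
  rfl

theorem prod_range_pow_sub_pow_add (n : ℕ) :
    ∏ i ∈ Finset.range n, ((X : ℤ⟦X⟧) ^ n - X ^ (n + 1 + i)) = X ^ (n * n) * qFactorial n := by
  have h1 : ∀ i ∈ Finset.range n, ((X : ℤ⟦X⟧) ^ n - X ^ (n + 1 + i)) =
      X ^ n * (1 - X ^ (i + 1)) := fun i _ => by ring
  rw [Finset.prod_congr rfl h1, Finset.prod_mul_distrib, Finset.prod_const, Finset.card_range,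
    ← pow_mul]
  rfl

theorem derivative_sum_eq (n : ℕ) :
    qFactorialInv (2 * n + 1) * ((-1) ^ (n + 1) * X ^ (n.choose 2 + n * n + n) *
      qFactorial n ^ 2) =
    ∑ j ∈ Finset.range (2 * n + 2), (-1) ^ j * (j : ℤ⟦X⟧) *
      X ^ (j.choose 2 + n * (2 * n + 1 - j)) * qFactorialInv j * qFactorialInv (2 * n + 1 - j) := by
  -- Take y = q^n and z = -t with t a polynomial variable. The factor i = n is q^n (1 - t), so the
  -- derivative at t = 1 retains only the product of the other factors.
  have hb := q_binomial (Polynomial.C (X : ℤ⟦X⟧)) (fun a => Polynomial.C (qFactorialInv a))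
    (by have := qFactorialInv_mul 0; simp [qFactorial] at this; simp [this])
    (fun a => by
      conv_lhs => rw [qFactorialInv_eq]
      simp)
    (fun a => by
      rw [← map_pow, ← map_one Polynomial.C, ← map_sub]
      exact (isUnit_one_sub_X_pow a).map _)
    (Polynomial.C (X ^ n)) (2 * n + 1) (-Polynomial.X)
  have hb2 := congrArg (fun p => Polynomial.eval 1 (Polynomial.derivative p)) hb
  beta_reduce at hb2
  rw [show 2 * n + 1 = n + 1 + n by ring, Finset.prod_range_add, Finset.prod_range_succ,
    show n + 1 + n = 2 * n + 1 by ring] at hb2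
  rw [Finset.Nat.sum_antidiagonal_eq_sum_range_succ_mk, Polynomial.derivative_sum,
    Polynomial.eval_finsetSum] at hb2
  convert hb2 using 1
  · have h4 : Polynomial.derivative (Polynomial.C (X : ℤ⟦X⟧) ^ n) = 0 := by
      rw [← map_pow, Polynomial.derivative_C]
    simp only [h4, Polynomial.derivative_mul, Polynomial.eval_mul, Polynomial.eval_add,
      Polynomial.derivative_C, Polynomial.eval_C, Polynomial.eval_prod, Polynomial.derivative_add,
      Polynomial.derivative_neg, Polynomial.derivative_X, Polynomial.eval_neg, Polynomial.eval_X,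
      Polynomial.eval_pow, Polynomial.eval_one, Polynomial.eval_zero]
    have a1 := prod_range_pow_sub_pow n
    have a2 := prod_range_pow_sub_pow_add n
    simp only [sub_eq_add_neg] at a1 a2
    simp only [neg_mul, one_mul, a1, a2]
    ring
  · refine Finset.sum_congr rfl fun j _ => ?_
    have h3 : Polynomial.C (X : ℤ⟦X⟧) ^ j.choose 2 * Polynomial.C (qFactorialInv j) *
        Polynomial.C (qFactorialInv (2 * n + 1 - j)) * (-Polynomial.X) ^ j *
        Polynomial.C (X ^ n) ^ (2 * n + 1 - j) =
        Polynomial.C ((-1) ^ j * X ^ (j.choose 2 + n * (2 * n + 1 - j)) * qFactorialInv j *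
          qFactorialInv (2 * n + 1 - j)) * Polynomial.X ^ j := by
      rw [neg_pow (Polynomial.X : Polynomial ℤ⟦X⟧) j]
      simp only [map_mul, map_pow, map_neg, map_one, pow_add, pow_mul]
      ring
    rw [h3]
    simp only [Polynomial.derivative_C_mul, Polynomial.derivative_X_pow, Polynomial.eval_mul,
      Polynomial.eval_C, Polynomial.eval_pow, Polynomial.eval_X, one_pow]
    ring

/-- A finite form of Jacobi's identity for the cube of the Euler product. -/
theorem finite_jacobi (n : ℕ) :
    qFactorialInv (2 * n + 1) * qFactorial n ^ 2 =
    ∑ k ∈ Finset.range (n + 1), (-1) ^ k * (2 * k + 1 : ℤ⟦X⟧) * X ^ (k + 1).choose 2 *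
      qFactorialInv (n - k) * qFactorialInv (n + 1 + k) := by
  have h := derivative_sum_eq n
  -- The terms j = n - k and j = n + 1 + k have equal powers of X and opposite signs, so their
  -- weights j combine to 2k + 1.
  rw [show 2 * n + 2 = (n + 1) + (n + 1) by ring, Finset.sum_range_add,
    ← Finset.sum_range_reflect _ (n + 1), ← Finset.sum_add_distrib] at h
  have hX : (X : ℤ⟦X⟧) ^ (n.choose 2 + n * n + n) ≠ 0 := pow_ne_zero _ X_ne_zero
  have hm : ((-1 : ℤ⟦X⟧)) ^ (n + 1) ≠ 0 := pow_ne_zero _ (by simp)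
  refine mul_left_cancel₀ (mul_ne_zero hm hX) ?_
  rw [Finset.mul_sum]
  refine Eq.trans (by ring) (h.trans (Finset.sum_congr rfl fun k hk => ?_))
  obtain ⟨m, rfl⟩ := Nat.exists_eq_add_of_le (Nat.le_of_lt_succ (Finset.mem_range.1 hk))
  rw [show k + m + 1 - 1 - k = m by omega, show 2 * (k + m) + 1 - m = k + m + 1 + k by omega,
    show 2 * (k + m) + 1 - (k + m + 1 + k) = m by omega, show k + m - k = m by omega]
  have key : ∀ a : ℕ, 2 * a.choose 2 + a = a * a := by
    intro a
    rcases a with _ | a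
    · rfl
    · rw [two_mul_choose_two]; ring
  have e0 := key (k + m)
  have e1 := key (k + 1)
  have e2 := key m
  have e3 := key (k + m + 1 + k)
  have E1 : m.choose 2 + (k + m) * (k + m + 1 + k) =
      ((k + m).choose 2 + (k + m) * (k + m) + (k + m)) + (k + 1).choose 2 := by nlinarith
  have E2 : (k + m + 1 + k).choose 2 + (k + m) * m =
      ((k + m).choose 2 + (k + m) * (k + m) + (k + m)) + (k + 1).choose 2 := by nlinarith
  rw [E1, E2, pow_add _ _ ((k + 1).choose 2)]
  have s1 : (-1 : ℤ⟦X⟧) ^ (k + m + 1 + k) = - (-1) ^ m := by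
    rw [show k + m + 1 + k = m + 2 * k + 1 by ring, pow_succ, pow_add, pow_mul]; simp
  have s2 : (-1 : ℤ⟦X⟧) ^ (k + m + 1) * (-1) ^ k = - (-1) ^ m := by
    rw [← pow_add, s1]
  push_cast
  linear_combination (X ^ ((k + m).choose 2 + (k + m) * (k + m) + (k + m)) * X ^ (k + 1).choose 2 *
    qFactorialInv m * qFactorialInv (k + m + 1 + k)) *
    ((k + m + 1 + k : ℤ⟦X⟧) * s1 - (2 * k + 1 : ℤ⟦X⟧) * s2)

/-! ### Passage to the limit in Jacobi's identity -/

theorem X_pow_dvd_prod_sub_one (m : ℕ) (s : Finset ℕ) (hs : ∀ i ∈ s, m ≤ i) :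
    (X : ℤ⟦X⟧) ^ (m + 1) ∣ ∏ i ∈ s, (1 - X ^ (i + 1)) - 1 := by
  induction s using Finset.induction_on with
  | empty => simp
  | insert a s ha ih =>
    rw [Finset.prod_insert ha]
    obtain ⟨c, hc⟩ := ih fun i hi => hs i (Finset.mem_insert_of_mem hi)
    obtain ⟨d, hd⟩ := Nat.exists_eq_add_of_le (hs a (Finset.mem_insert_self a s))
    refine ⟨(1 - X ^ (a + 1)) * c - X ^ d, ?_⟩
    rw [show a + 1 = (m + 1) + d by omega, pow_add]
    linear_combination (1 - X ^ (m + 1) * X ^ d) * hc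

theorem X_pow_dvd_euler_sub_qFactorial (m : ℕ) :
    (X : ℤ⟦X⟧) ^ (m + 1) ∣ pentagonalSeries ℤ - qFactorial m := by
  rw [X_pow_dvd_iff]
  intro d hd
  obtain ⟨s, hs⟩ := Filter.eventually_atTop.1 (coeff_prod_one_sub_X_pow_eventually_eq ℤ d)
  have h1 := hs (s ∪ Finset.range m) Finset.subset_union_left
  rw [map_sub, ← h1, ← Finset.prod_sdiff (Finset.subset_union_right (s₁ := s)), ← map_sub]
  refine X_pow_dvd_iff.1 (?_ : (X : ℤ⟦X⟧) ^ (m + 1) ∣ _) d hd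
  obtain ⟨c, hc⟩ := X_pow_dvd_prod_sub_one m ((s ∪ Finset.range m) \ Finset.range m)
    (fun i hi => by simpa using (Finset.mem_sdiff.1 hi).2)
  refine ⟨c * qFactorial m, ?_⟩
  rw [qFactorial]
  linear_combination (∏ i ∈ Finset.range m, (1 - (X : ℤ⟦X⟧) ^ (i + 1))) * hc

/-- The series `∑ (-1) ^ k * (2 * k + 1) * X ^ (k * (k + 1) / 2)`. -/
noncomputable def jacobiSeries : ℤ⟦X⟧ :=
  PowerSeries.mk fun d => ∑ k ∈ Finset.range (d + 1),
    if (k + 1).choose 2 = d then (-1) ^ k * (2 * k + 1 : ℤ) else 0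

theorem le_choose_two_succ (k : ℕ) : k ≤ (k + 1).choose 2 := by
  have := two_mul_choose_two k
  rcases k with _ | k
  · simp
  · nlinarith

theorem coeff_jacobiSeries_eq_sum {d n : ℕ} (h : d ≤ n) : coeff d jacobiSeries =
    ∑ k ∈ Finset.range (n + 1),
      if (k + 1).choose 2 = d then (-1) ^ k * (2 * k + 1 : ℤ) else 0 := by
  rw [jacobiSeries, coeff_mk]
  refine Finset.sum_subset (Finset.range_subset_range.2 (by omega)) fun k _ hk => ?_
  rw [Finset.mem_range, not_lt] at hk
  have := le_choose_two_succ k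
  rw [if_neg (by omega)]

theorem choose_two_succ_injective {k l : ℕ} (h : (k + 1).choose 2 = (l + 1).choose 2) : k = l := by
  have h1 := two_mul_choose_two k
  have h2 := two_mul_choose_two l
  rw [h, h2] at h1
  by_contra hne
  rcases Nat.lt_or_gt_of_ne hne with h3 | h3 <;> nlinarith

theorem coeff_jacobiSeries_choose (k : ℕ) :
    coeff ((k + 1).choose 2) jacobiSeries = (-1) ^ k * (2 * k + 1 : ℤ) := by
  rw [jacobiSeries, coeff_mk, Finset.sum_eq_single k]
  · simp
  · intro l _ hl
    rw [if_neg fun h => hl (choose_two_succ_injective h)]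
  · intro h
    exact absurd (Finset.mem_range.2 (Nat.lt_succ_of_le (le_choose_two_succ k))) h

theorem coeff_jacobiSeries_eq_zero {d : ℕ} (h : ∀ k : ℕ, (k + 1).choose 2 ≠ d) :
    coeff d jacobiSeries = 0 := by
  rw [jacobiSeries, coeff_mk]
  exact Finset.sum_eq_zero fun k _ => if_neg (h k)

/-- Jacobi's identity for the cube of the Euler product. -/
theorem euler_pow_three : pentagonalSeries ℤ ^ 3 = jacobiSeries := by
  ext n
  set e := pentagonalSeries ℤ with he
  have hinv : ∀ m : ℕ, ∃ c : ℤ⟦X⟧, e * qFactorialInv m = 1 + X ^ (m + 1) * c := by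
    intro m
    obtain ⟨c, hc⟩ := X_pow_dvd_euler_sub_qFactorial m
    refine ⟨c * qFactorialInv m, ?_⟩
    linear_combination qFactorialInv m * hc + qFactorialInv_mul m
  obtain ⟨c, hc⟩ := X_pow_dvd_euler_sub_qFactorial n
  obtain ⟨c1, hc1⟩ := hinv (2 * n + 1)
  have hL : (X : ℤ⟦X⟧) ^ (n + 1) ∣
      e ^ 3 - e ^ 2 * (qFactorialInv (2 * n + 1) * qFactorial n ^ 2) := by
    have h2 : (X : ℤ⟦X⟧) ^ (n + 1) ∣ e - qFactorial n := ⟨c, hc⟩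
    have h3 : (X : ℤ⟦X⟧) ^ (n + 1) ∣ e * qFactorialInv (2 * n + 1) - 1 := by
      rw [hc1, add_sub_cancel_left]
      exact (pow_dvd_pow _ (by omega)).mul_right _
    have h4 : e ^ 3 - e ^ 2 * (qFactorialInv (2 * n + 1) * qFactorial n ^ 2) =
        (e - qFactorial n) * (e + qFactorial n) * e -
        (e * qFactorialInv (2 * n + 1) - 1) * (e * qFactorial n ^ 2) := by ring
    rw [h4]
    exact dvd_sub ((h2.mul_right _).mul_right _) (h3.mul_right _)
  have hR : (X : ℤ⟦X⟧) ^ (n + 1) ∣ e ^ 2 * (qFactorialInv (2 * n + 1) * qFactorial n ^ 2) -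
      ∑ k ∈ Finset.range (n + 1), (-1) ^ k * (2 * k + 1 : ℤ⟦X⟧) * X ^ (k + 1).choose 2 := by
    rw [finite_jacobi, Finset.mul_sum, ← Finset.sum_sub_distrib]
    refine Finset.dvd_sum fun k hk => ?_
    obtain ⟨m, rfl⟩ := Nat.exists_eq_add_of_le (Nat.le_of_lt_succ (Finset.mem_range.1 hk))
    obtain ⟨u, hu⟩ := hinv (k + m - k)
    obtain ⟨v, hv⟩ := hinv (k + m + 1 + k)
    have h5 : e ^ 2 * ((-1) ^ k * (2 * k + 1 : ℤ⟦X⟧) * X ^ (k + 1).choose 2 *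
        qFactorialInv (k + m - k) * qFactorialInv (k + m + 1 + k)) -
        (-1) ^ k * (2 * k + 1 : ℤ⟦X⟧) * X ^ (k + 1).choose 2 =
        (-1) ^ k * (2 * k + 1 : ℤ⟦X⟧) * (X ^ (k + 1).choose 2 *
          ((e * qFactorialInv (k + m - k)) * (e * qFactorialInv (k + m + 1 + k)) - 1)) := by ring
    rw [h5, hu, hv]
    refine Dvd.dvd.mul_left ?_ _
    -- The error in the k-th term has order only n - k + 1; the factor X^(k(k+1)/2) makes up the
    -- missing k.
    have h6 : (X : ℤ⟦X⟧) ^ (k + m + 1) ∣ X ^ (k + 1).choose 2 * X ^ (k + m - k + 1) := by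
      rw [← pow_add]
      have := le_choose_two_succ k
      exact pow_dvd_pow _ (by omega)
    have h7 : (X : ℤ⟦X⟧) ^ (k + m - k + 1) ∣
        (1 + X ^ (k + m - k + 1) * u) * (1 + X ^ (k + m + 1 + k + 1) * v) - 1 := by
      refine ⟨u * (1 + X ^ (k + m + 1 + k + 1) * v) + X ^ (2 * k + 1) * v, ?_⟩
      rw [show k + m + 1 + k + 1 = (k + m - k + 1) + (2 * k + 1) by omega, pow_add]
      ring
    exact h6.trans (mul_dvd_mul_left _ h7)
  have hall := dvd_add hL hR
  rw [sub_add_sub_cancel, X_pow_dvd_iff] at hall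
  have h8 := hall n (Nat.lt_succ_self n)
  rw [map_sub, sub_eq_zero] at h8
  rw [h8, coeff_jacobiSeries_eq_sum le_rfl, map_sum]
  refine Finset.sum_congr rfl fun k _ => ?_
  have h9 : (-1) ^ k * (2 * k + 1 : ℤ⟦X⟧) = C ((-1) ^ k * (2 * k + 1 : ℤ)) := by simp
  rw [h9, coeff_C_mul, coeff_X_pow]
  simp [eq_comm]

/-! ### Trisection and the 3-dissection of the cubed Euler product -/

/-- The operator sending `∑ a n X ^ n` to `∑ a (3 n) X ^ n`. -/
noncomputable def section3 : ℤ⟦X⟧ →+ ℤ⟦X⟧ where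
  toFun f := PowerSeries.mk fun n => coeff (3 * n) f
  map_zero' := by ext n; simp
  map_add' f g := by ext n; simp

@[simp] theorem coeff_section3 (n : ℕ) (f : ℤ⟦X⟧) : coeff n (section3 f) = coeff (3 * n) f := by
  exact coeff_mk n fun n => coeff (3 * n) f

/-- The ring homomorphism `f(X) ↦ f(X ^ 3)`. -/
noncomputable def expand3 : ℤ⟦X⟧ →ₐ[ℤ] ℤ⟦X⟧ := PowerSeries.expand 3 three_ne_zero

theorem coeff_expand3_mul (n : ℕ) (f : ℤ⟦X⟧) : coeff (3 * n) (expand3 f) = coeff n f :=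
  coeff_expand_mul 3 three_ne_zero f n

theorem coeff_expand3_of_not_dvd {n : ℕ} (h : ¬ 3 ∣ n) (f : ℤ⟦X⟧) : coeff n (expand3 f) = 0 :=
  coeff_expand_of_not_dvd 3 three_ne_zero f h

theorem section3_expand3_mul (g f : ℤ⟦X⟧) : section3 (expand3 g * f) = g * section3 f := by
  ext n
  rw [coeff_section3, coeff_mul, coeff_mul]
  symm
  refine Finset.sum_of_injOn (fun p => (3 * p.1, 3 * p.2)) ?_ ?_ ?_ ?_
  · rintro ⟨a, b⟩ _ ⟨c, d⟩ _ h
    simp only [Prod.mk.injEq] at h ⊢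
    omega
  · rintro ⟨a, b⟩ h
    simp only [Finset.mem_coe, Finset.HasAntidiagonal.mem_antidiagonal] at h ⊢
    omega
  · rintro ⟨a, b⟩ h h'
    by_cases h3 : 3 ∣ a
    · exfalso
      apply h'
      obtain ⟨c, rfl⟩ := h3
      have hc : 3 * c + b = 3 * n := Finset.HasAntidiagonal.mem_antidiagonal.1 h
      refine ⟨(c, n - c), ?_, ?_⟩
      · exact Finset.HasAntidiagonal.mem_antidiagonal.2 (Nat.add_sub_cancel' (by omega))
      · exact Prod.ext rfl (show 3 * (n - c) = b by omega)
    · simp [coeff_expand3_of_not_dvd h3]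
  · rintro ⟨a, b⟩ _
    simp [coeff_expand3_mul]

theorem section3_one : section3 1 = 1 := by
  ext n
  rw [coeff_section3, coeff_one, coeff_one]
  simp

theorem section3_expand3 (g : ℤ⟦X⟧) : section3 (expand3 g) = g := by
  simpa [section3_one] using section3_expand3_mul g 1

/-- The 3-dissection of the cube of the Euler product. -/
theorem euler_pow_three_dissection :
    pentagonalSeries ℤ ^ 3 = expand3 (section3 (pentagonalSeries ℤ ^ 3)) -
      3 * X * expand3 (expand3 (pentagonalSeries ℤ ^ 3)) := by
  -- Triangular numbers are divisible by 3 unless k = 3l + 1, where the value is 9·l(l+1)/2 + 1 and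
  -- the coefficient 2k + 1 = 3(2l + 1) supplies the factor 3.
  have hmod : ∀ k : ℕ, (∃ l, k = 3 * l ∨ k = 3 * l + 2) ∧ 3 ∣ (k + 1).choose 2 ∨
      ∃ l, k = 3 * l + 1 ∧ (k + 1).choose 2 = 3 * (3 * (l + 1).choose 2) + 1 := by
    intro k
    have hk := two_mul_choose_two k
    obtain ⟨l, h | h | h⟩ : ∃ l, k = 3 * l ∨ k = 3 * l + 1 ∨ k = 3 * l + 2 :=
      ⟨k / 3, by omega⟩
    · refine Or.inl ⟨⟨l, Or.inl h⟩, ?_⟩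
      have : 3 ∣ 2 * (k + 1).choose 2 := by rw [hk, h]; exact ⟨l * (3 * l + 1), by ring⟩
      omega
    · refine Or.inr ⟨l, h, ?_⟩
      have hl := two_mul_choose_two l
      rw [h] at hk ⊢
      nlinarith
    · refine Or.inl ⟨⟨l, Or.inr h⟩, ?_⟩
      have : 3 ∣ 2 * (k + 1).choose 2 := by rw [hk, h]; exact ⟨(3 * l + 2) * (l + 1), by ring⟩
      omega
  rw [euler_pow_three]
  ext n
  rw [map_sub, show (3 : ℤ⟦X⟧) = C 3 by simp, mul_assoc, coeff_C_mul]
  obtain ⟨m, h | h | h⟩ : ∃ m, n = 3 * m ∨ n = 3 * m + 1 ∨ n = 3 * m + 2 := ⟨n / 3, by omega⟩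
  · have h0 : coeff n (X * expand3 (expand3 jacobiSeries)) = 0 := by
      rcases n with _ | n
      · simp
      · rw [coeff_succ_X_mul, coeff_expand3_of_not_dvd (by omega)]
    rw [h0, h, coeff_expand3_mul, coeff_section3]
    ring
  · rw [coeff_expand3_of_not_dvd (by omega), h, coeff_succ_X_mul, coeff_expand3_mul]
    by_cases ht : ∃ l : ℕ, 3 * (l + 1).choose 2 = m
    · obtain ⟨l, rfl⟩ := ht
      have h1 : (3 * l + 1 + 1).choose 2 = 3 * (3 * (l + 1).choose 2) + 1 := by
        rcases hmod (3 * l + 1) with ⟨⟨l', h'⟩, _⟩ | ⟨l', h', h2⟩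
        · omega
        · obtain rfl : l = l' := by omega
          exact h2
      rw [coeff_expand3_mul, ← h1, coeff_jacobiSeries_choose, coeff_jacobiSeries_choose, pow_succ,
        pow_mul]
      push_cast
      ring
    · rw [coeff_jacobiSeries_eq_zero]
      · by_cases h3 : 3 ∣ m
        · obtain ⟨r, rfl⟩ := h3
          rw [coeff_expand3_mul, coeff_jacobiSeries_eq_zero]
          · simp
          · exact fun l hl => ht ⟨l, by rw [hl]⟩
        · rw [coeff_expand3_of_not_dvd h3]
          simp
      · intro k hk
        rcases hmod k with ⟨_, h2⟩ | ⟨l, _, h2⟩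
        · omega
        · exact ht ⟨l, by omega⟩
  · rw [coeff_expand3_of_not_dvd (by omega), h, coeff_succ_X_mul,
      coeff_expand3_of_not_dvd (by omega), coeff_jacobiSeries_eq_zero]
    · simp
    · intro k hk
      rcases hmod k with ⟨_, h2⟩ | ⟨l, _, h2⟩ <;> omega

/-! ### Infinite products and cube roots of unity -/

section EulerProducts

open scoped PowerSeries.WithPiTopology

variable {R : Type*} [CommRing R] [TopologicalSpace R]

theorem continuous_expand (m : ℕ) (hm : m ≠ 0) :
    Continuous (PowerSeries.expand m hm : R⟦X⟧ → R⟦X⟧) := by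
  rw [continuous_iff_continuousAt]
  intro f
  rw [ContinuousAt, WithPiTopology.tendsto_iff_coeff_tendsto]
  intro d
  simp only [coeff_expand]
  split_ifs
  · exact (WithPiTopology.continuous_coeff R _).continuousAt
  · exact tendsto_const_nhds

theorem continuous_rescale [IsTopologicalRing R] (a : R) :
    Continuous (PowerSeries.rescale a : R⟦X⟧ → R⟦X⟧) := by
  rw [continuous_iff_continuousAt]
  intro f
  rw [ContinuousAt, WithPiTopology.tendsto_iff_coeff_tendsto]
  intro d
  simp only [coeff_rescale]
  exact (continuous_const.mul (WithPiTopology.continuous_coeff R d)).continuousAt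

theorem hasProd_expand_euler (m : ℕ) (hm : m ≠ 0) :
    HasProd (fun i : ℕ => (1 : R⟦X⟧) - X ^ (m * (i + 1)))
      (PowerSeries.expand m hm (pentagonalSeries R)) := by
  have h := (WithPiTopology.hasProd_one_sub_X_pow R).map (PowerSeries.expand m hm)
    (continuous_expand m hm)
  convert h using 2 with i
  simp [pow_mul]

/-- Padding with trivial factors puts all the Euler products on one index set, so that identities
between them can be checked factor by factor. -/
theorem hasProd_expand_euler_ite (m : ℕ) (hm : m ≠ 0) :
    HasProd (fun i : ℕ => if m ∣ i + 1 then (1 : R⟦X⟧) - X ^ (i + 1) else 1)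
      (PowerSeries.expand m hm (pentagonalSeries R)) := by
  have hpos : 0 < m := Nat.pos_of_ne_zero hm
  have hidx : ∀ i : ℕ, m * (i + 1) - 1 + 1 = m * (i + 1) := fun i =>
    Nat.sub_add_cancel (Nat.mul_pos hpos i.succ_pos)
  have hinj : Function.Injective fun i : ℕ => m * (i + 1) - 1 := by
    intro a b h
    have h1 : m * (a + 1) = m * (b + 1) := by
      rw [← hidx a, ← hidx b]; exact congrArg (· + 1) h
    exact Nat.succ_injective (Nat.eq_of_mul_eq_mul_left hpos h1)
  rw [← hinj.hasProd_iff]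
  · convert hasProd_expand_euler (R := R) m hm using 2 with i
    simp [hidx]
  · intro x hx
    rw [if_neg]
    rintro ⟨c, hc⟩
    rcases c with _ | c
    · simp at hc
    · exact hx ⟨c, by simp only; omega⟩

end EulerProducts

section CubeRoot

open scoped PowerSeries.WithPiTopology

variable {R : Type*} [CommRing R]

theorem rescale_expand_three {w : R} (hw : w ^ 3 = 1) (f : R⟦X⟧) :
    rescale w (PowerSeries.expand 3 three_ne_zero f) = PowerSeries.expand 3 three_ne_zero f := by
  ext n
  rw [coeff_rescale, coeff_expand]
  split_ifs with h
  · obtain ⟨k, rfl⟩ := h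
    rw [pow_mul, hw, one_pow, one_mul]
  · rw [mul_zero]

/-- When 3 does not divide n, the powers 1, w^n, w^(2n) run through the roots 1, w, w^2; otherwise
all three equal 1. -/
theorem one_sub_mul_cube_roots {S : Type*} [CommRing S] {w : S} (hw : 1 + w + w ^ 2 = 0) (n : ℕ)
    (a : S) : (1 - a) * (1 - w ^ n * a) * (1 - (w ^ 2) ^ n * a) =
      if 3 ∣ n then (1 - a) ^ 3 else 1 - a ^ 3 := by
  have hw3 : w ^ 3 = 1 := by linear_combination (w - 1) * hw
  have key : ∀ v : S, 1 + v + v ^ 2 = 0 → (1 - a) * (1 - v * a) * (1 - v ^ 2 * a) = 1 - a ^ 3 := by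
    intro v hv
    linear_combination (-a + a ^ 2 * v - a ^ 3 * (v - 1)) * hv
  rw [← pow_mul, mul_comm 2 n, pow_mul]
  obtain ⟨m, h | h | h⟩ : ∃ m, n = 3 * m ∨ n = 3 * m + 1 ∨ n = 3 * m + 2 := ⟨n / 3, by omega⟩
  · rw [if_pos ⟨m, h⟩, h, pow_mul, hw3]
    ring
  · rw [if_neg (by omega), h, pow_add, pow_mul, hw3, one_pow, one_mul, pow_one, key w hw]
  · rw [if_neg (by omega), h, pow_add, pow_mul, hw3, one_pow, one_mul, key]
    linear_combination hw + w * hw3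

theorem euler_mul_rescale_cube_roots {w : R} (hw : 1 + w + w ^ 2 = 0) :
    pentagonalSeries R * rescale w (pentagonalSeries R) * rescale (w ^ 2) (pentagonalSeries R) *
      PowerSeries.expand 3 three_ne_zero (PowerSeries.expand 3 three_ne_zero (pentagonalSeries R)) =
    PowerSeries.expand 3 three_ne_zero (pentagonalSeries R) ^ 4 := by
  let : TopologicalSpace R := ⊥
  have : DiscreteTopology R := ⟨rfl⟩
  have h1 := WithPiTopology.hasProd_one_sub_X_pow R
  have h2 := h1.map (rescale w) (continuous_rescale w)
  have h3 := h1.map (rescale (w ^ 2)) (continuous_rescale (w ^ 2))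
  have h4 := (hasProd_expand_euler_ite (R := R) 3 three_ne_zero).map
    (PowerSeries.expand 3 three_ne_zero) (continuous_expand 3 three_ne_zero)
  have h5 := hasProd_expand_euler_ite (R := R) 3 three_ne_zero
  have h6 := hasProd_expand_euler (R := R) 3 three_ne_zero
  have h7 := ((h1.mul h2).mul h3).mul h4
  have h8 := ((h5.mul h5).mul h5).mul h6
  rw [show ∀ a : R⟦X⟧, a ^ 4 = a * a * a * a from fun a => by ring]
  refine HasProd.unique h7 ?_
  convert h8 using 2 with i
  have hC : 1 + C w + (C w) ^ 2 = (0 : R⟦X⟧) := by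
    rw [← map_pow, ← map_one (C (R := R)), ← map_add, ← map_add, hw, map_zero]
  have hk := one_sub_mul_cube_roots hC (i + 1) ((X : R⟦X⟧) ^ (i + 1))
  by_cases h : 3 ∣ i + 1
  · simp only [Function.comp_apply, map_sub, map_one, map_pow, rescale_X, if_pos h, expand_X,
      mul_pow] at hk ⊢
    rw [hk, ← pow_mul]
    ring
  · simp only [Function.comp_apply, map_sub, map_one, map_pow, rescale_X, if_neg h,
      mul_pow] at hk ⊢
    rw [hk, ← pow_mul, mul_comm 3 (i + 1)]
    ring

theorem map_pentagonalSeries {S : Type*} [CommRing S] (f : R →+* S) :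
    PowerSeries.map f (pentagonalSeries R) = pentagonalSeries S := by
  ext n
  rw [coeff_map]
  by_cases h : n ∈ Set.range pentagonal
  · obtain ⟨k, rfl⟩ := h
    simp
  · rw [coeff_pentagonalSeries_eq_zero R h, coeff_pentagonalSeries_eq_zero S h, map_zero]

end CubeRoot

/-- If `x - y` is the 3-dissection of the cube of the Euler product, then `x ^ 3 - y ^ 3` is an
eta quotient in `X ^ 3`. -/
theorem dissection_cube_sub_cube :
    (expand3 (section3 (pentagonalSeries ℤ ^ 3)) ^ 3 -
      (3 * X * expand3 (expand3 (pentagonalSeries ℤ ^ 3))) ^ 3) *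
      expand3 (expand3 (pentagonalSeries ℤ)) ^ 3 = expand3 (pentagonalSeries ℤ) ^ 12 := by
  obtain ⟨w, hw⟩ : ∃ w : ℂ, 1 + w + w ^ 2 = 0 := by
    have h := (Complex.isPrimitiveRoot_exp 3 (by norm_num)).geom_sum_eq_zero (by norm_num)
    exact ⟨_, by simpa only [Finset.sum_range_succ, Finset.sum_range_zero, pow_zero, pow_one,
      zero_add] using h⟩
  have hw3 : w ^ 3 = 1 := by linear_combination (w - 1) * hw
  have hw32 : (w ^ 2) ^ 3 = 1 := by rw [← pow_mul, mul_comm, pow_mul, hw3, one_pow]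
  have hinj := PowerSeries.map_injective (Int.castRingHom ℂ) Int.cast_injective
  apply hinj
  have hd := congrArg (PowerSeries.map (Int.castRingHom ℂ)) euler_pow_three_dissection
  have hexp : ∀ f : ℤ⟦X⟧, PowerSeries.map (Int.castRingHom ℂ) (expand3 f) =
      PowerSeries.expand 3 three_ne_zero (PowerSeries.map (Int.castRingHom ℂ) f) := fun f =>
    PowerSeries.map_expand 3 three_ne_zero _ f
  have hp := euler_mul_rescale_cube_roots hw
  have hC : 1 + C w + (C w) ^ 2 = (0 : ℂ⟦X⟧) := by
    rw [← map_pow, ← map_one (C (R := ℂ)), ← map_add, ← map_add, hw, map_zero]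
  simp only [map_mul, map_sub, map_pow, map_ofNat, hexp, map_pentagonalSeries, PowerSeries.map_X]
    at hd ⊢
  set A := PowerSeries.map (Int.castRingHom ℂ) (section3 (pentagonalSeries ℤ ^ 3))
  set e := pentagonalSeries ℂ
  set e3 := PowerSeries.expand 3 three_ne_zero e
  set e9 := PowerSeries.expand 3 three_ne_zero e3
  have hd1 := congrArg (rescale w) hd
  have hd2 := congrArg (rescale (w ^ 2)) hd
  simp only [map_mul, map_sub, map_pow, map_ofNat, rescale_X, rescale_expand_three hw3,
    rescale_expand_three hw32, e9] at hd1 hd2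
  change _ = PowerSeries.expand 3 three_ne_zero A - 3 * (C w * X) * e9 ^ 3 at hd1
  set x := PowerSeries.expand 3 three_ne_zero A
  change _ = x - 3 * (C w ^ 2 * X) * e9 ^ 3 at hd2
  -- Rescaling by w fixes series in X^3 and multiplies y by w, so x^3 - y^3 = (x - y)(x - wy)(x -
  -- w^2 y) is a product of three rescaled copies of e^3.
  have hx : x ^ 3 - 3 ^ 3 * X ^ 3 * (e9 ^ 3) ^ 3 =
      (e * rescale w e * rescale (w ^ 2) e) ^ 3 := by
    rw [mul_pow (e * rescale w e), mul_pow e, hd, hd1, hd2]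
    linear_combination (3 * X * e9 ^ 3 * x ^ 2 - C w * x * (3 * X * e9 ^ 3) ^ 2 +
      (C w - 1) * (3 * X * e9 ^ 3) ^ 3) * hC
  rw [mul_pow, mul_pow, hx, ← mul_pow, hp, ← pow_mul]

/-! ### Partitions with restricted parts -/

/-- The generating function of partitions with restricted parts. -/
theorem mk_card_restricted_mul_euler {a b : ℕ} (ha : a ≠ 0) (hb : b ≠ 0) (bad : ℕ → Prop)
    [DecidablePred bad] (hbad : ∀ i, bad i ↔ a ∣ i ∧ ¬ b ∣ i) (hab : a ∣ b) :
    PowerSeries.mk (fun n => ((Nat.Partition.restricted n fun p => ¬ bad p).card : ℤ)) *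
      pentagonalSeries ℤ * PowerSeries.expand b hb (pentagonalSeries ℤ) =
    PowerSeries.expand a ha (pentagonalSeries ℤ) := by
  open scoped PowerSeries.WithPiTopology in
  have h1 := Nat.Partition.hasProd_powerSeriesMk_card_restricted ℤ (fun p => ¬ bad p)
  have h2 := (h1.mul (WithPiTopology.hasProd_one_sub_X_pow ℤ)).mul
    (hasProd_expand_euler_ite (R := ℤ) b hb)
  refine h2.unique ?_
  convert! hasProd_expand_euler_ite (R := ℤ) a ha using 2 with i
  have hg : (∑' j : ℕ, (X : ℤ⟦X⟧) ^ ((i + 1) * j)) * (1 - X ^ (i + 1)) = 1 := by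
    simp_rw [pow_mul]
    exact WithPiTopology.tsum_pow_mul_one_sub_of_constantCoeff_eq_zero (by simp)
  by_cases hbi : b ∣ i + 1
  · have hai := hab.trans hbi
    rw [if_pos (by rw [hbad]; tauto), if_pos hbi, if_pos hai, hg, one_mul]
  · by_cases hai : a ∣ i + 1
    · rw [if_neg (by rw [hbad]; tauto), if_neg hbi, if_pos hai]
      ring
    · rw [if_pos (by rw [hbad]; tauto), if_neg hbi, if_neg hai, hg, one_mul]

/-! ### The eta quotients ζ and Z and their relations -/

theorem isUnit_euler : IsUnit (pentagonalSeries ℤ) := by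
  obtain ⟨c, hc⟩ := X_pow_dvd_euler_sub_qFactorial 0
  rw [PowerSeries.isUnit_iff_constantCoeff, eq_add_of_sub_eq hc]
  simp [qFactorial]

/-- The reciprocal of the Euler product. -/
noncomputable def eulerInv : ℤ⟦X⟧ := (isUnit_euler.unit⁻¹ : ℤ⟦X⟧ˣ)

theorem euler_mul_eulerInv : pentagonalSeries ℤ * eulerInv = 1 := isUnit_euler.mul_val_inv

theorem expand3_euler_mul_eulerInv : expand3 (pentagonalSeries ℤ) * expand3 eulerInv = 1 := by
  rw [← map_mul, euler_mul_eulerInv, map_one]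

theorem expand3_X : expand3 X = X ^ 3 := PowerSeries.expand_X 3 three_ne_zero

/-- The eta quotient `X * E(X ^ 9) ^ 3 / E(X) ^ 3`. -/
noncomputable def quotNine : ℤ⟦X⟧ :=
  X * expand3 (expand3 (pentagonalSeries ℤ)) ^ 3 * eulerInv ^ 3

/-- The eta quotient `X * E(X ^ 3) ^ 12 / E(X) ^ 12`. -/
noncomputable def quotThree : ℤ⟦X⟧ :=
  X * expand3 (pentagonalSeries ℤ) ^ 12 * eulerInv ^ 12

theorem euler_pow_three_eq : pentagonalSeries ℤ ^ 3 =
    expand3 (section3 (pentagonalSeries ℤ ^ 3)) -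
      3 * (X * expand3 (expand3 (pentagonalSeries ℤ)) ^ 3) := by
  conv_lhs => rw [euler_pow_three_dissection, map_pow expand3 (pentagonalSeries ℤ),
    map_pow expand3 (expand3 (pentagonalSeries ℤ))]
  ring

/-- The 3-dissection of the reciprocal of the cube of the Euler product. -/
theorem eulerInv_pow_three : eulerInv ^ 3 =
    expand3 (expand3 (pentagonalSeries ℤ) ^ 3 * eulerInv ^ 12) *
      (expand3 (section3 (pentagonalSeries ℤ ^ 3)) ^ 2 +
        3 * expand3 (section3 (pentagonalSeries ℤ ^ 3)) *
          (X * expand3 (expand3 (pentagonalSeries ℤ)) ^ 3) +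
        9 * (X * expand3 (expand3 (pentagonalSeries ℤ)) ^ 3) ^ 2) := by
  have h1 := euler_pow_three_eq
  have h2 := dissection_cube_sub_cube
  rw [map_pow expand3 (pentagonalSeries ℤ), map_pow expand3 (expand3 (pentagonalSeries ℤ))] at h2
  have h3 : pentagonalSeries ℤ ^ 3 * eulerInv ^ 3 = 1 := by
    rw [← mul_pow, euler_mul_eulerInv, one_pow]
  have h4 : expand3 (pentagonalSeries ℤ) ^ 12 * expand3 eulerInv ^ 12 = 1 := by
    rw [← mul_pow, expand3_euler_mul_eulerInv, one_pow]
  simp only [map_mul, map_pow]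
  generalize expand3 (section3 (pentagonalSeries ℤ ^ 3)) = x at *
  generalize expand3 (expand3 (pentagonalSeries ℤ)) = a at *
  generalize expand3 eulerInv = d at *
  generalize expand3 (pentagonalSeries ℤ) = b at *
  generalize pentagonalSeries ℤ = e at *
  generalize eulerInv = f at *
  -- This is 1/(x - y) = (x^2 + xy + y^2)/(x^3 - y^3) with y = 3Xa^3 and x^3 - y^3 = b^12/a^3.
  linear_combination (-f ^ 3) * h4 - f ^ 3 * d ^ 12 * h2 +
    d ^ 12 * a ^ 3 * (x ^ 2 + 3 * x * (X * a ^ 3) + 9 * (X * a ^ 3) ^ 2) * (h3 - f ^ 3 * h1)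

theorem quotNine_pow_three :
    quotNine ^ 3 = expand3 quotThree * (1 + 9 * quotNine + 27 * quotNine ^ 2) := by
  have h1 := euler_pow_three_eq
  have h2 := eulerInv_pow_three
  have h3 : pentagonalSeries ℤ ^ 3 * eulerInv ^ 3 = 1 := by
    rw [← mul_pow, euler_mul_eulerInv, one_pow]
  simp only [quotNine, quotThree, map_mul, map_pow, expand3_X] at h1 h2 ⊢
  generalize expand3 (section3 (pentagonalSeries ℤ ^ 3)) = x at *
  generalize expand3 (expand3 (pentagonalSeries ℤ)) = a at *
  generalize expand3 eulerInv = d at *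
  generalize expand3 (pentagonalSeries ℤ) = b at *
  generalize pentagonalSeries ℤ = e at *
  generalize eulerInv = f at *
  obtain rfl : x = e ^ 3 + 3 * (X * a ^ 3) := by linear_combination -h1
  generalize e ^ 3 = E at *
  generalize f ^ 3 = F at *
  linear_combination (X ^ 3 * a ^ 9) * (F ^ 2 * h2 + a ^ 3 * d ^ 12 * ((E * F + 1) * h3 +
    9 * (X * a ^ 3) * F * h3))

theorem quotThree_mul_expand3 : quotThree * expand3 quotThree = quotNine ^ 4 := by
  have h4 : expand3 (pentagonalSeries ℤ) ^ 12 * expand3 eulerInv ^ 12 = 1 := by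
    rw [← mul_pow, expand3_euler_mul_eulerInv, one_pow]
  simp only [quotNine, quotThree, map_mul, map_pow, expand3_X]
  linear_combination (X ^ 4 * expand3 (expand3 (pentagonalSeries ℤ)) ^ 12 * eulerInv ^ 12) * h4

theorem section3_X : section3 X = 0 := by
  ext n
  rw [coeff_section3, coeff_X, if_neg (by omega), map_zero]

theorem section3_X_sq : section3 (X ^ 2) = 0 := by
  ext n
  rw [coeff_section3, coeff_X_pow, if_neg (by omega), map_zero]

theorem section3_linear_comb (a b c : ℤ⟦X⟧) :
    section3 (expand3 a + expand3 b * X + expand3 c * X ^ 2) = a := by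
  rw [map_add, map_add, section3_expand3, section3_expand3_mul, section3_expand3_mul, section3_X,
    section3_X_sq, mul_zero, mul_zero, add_zero, add_zero]

theorem section3_quotNine : section3 quotNine = 9 * quotThree := by
  set A := section3 (pentagonalSeries ℤ ^ 3)
  set e := pentagonalSeries ℤ
  have h : quotNine = expand3 (9 * quotThree) +
      expand3 (expand3 e ^ 6 * eulerInv ^ 12 * A ^ 2) * X +
      expand3 (3 * expand3 e ^ 9 * eulerInv ^ 12 * A) * X ^ 2 := by
    rw [quotNine, eulerInv_pow_three]
    simp only [quotThree, map_mul, map_pow, expand3_X, map_ofNat]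
    ring
  rw [h, section3_linear_comb]

theorem section3_euler_pow_three_pow_three :
    section3 (pentagonalSeries ℤ ^ 3) ^ 3 * expand3 (pentagonalSeries ℤ) ^ 3 =
      pentagonalSeries ℤ ^ 12 + 27 * X * expand3 (pentagonalSeries ℤ) ^ 12 := by
  set A := section3 (pentagonalSeries ℤ ^ 3)
  have h : expand3 ((A ^ 3 - 27 * X * expand3 (pentagonalSeries ℤ) ^ 9) *
      expand3 (pentagonalSeries ℤ) ^ 3) = expand3 (pentagonalSeries ℤ ^ 12) := by
    rw [map_pow expand3 (pentagonalSeries ℤ), ← dissection_cube_sub_cube]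
    simp only [map_mul, map_pow, map_sub, expand3_X, map_ofNat, A]
    ring
  have h2 := congrArg section3 h
  rw [section3_expand3, section3_expand3] at h2
  linear_combination h2

theorem section3_quotNine_sq :
    section3 (quotNine ^ 2) = 6 * quotThree + 243 * quotThree ^ 2 := by
  have hc := section3_euler_pow_three_pow_three
  have hi : pentagonalSeries ℤ ^ 12 * eulerInv ^ 12 = 1 := by
    rw [← mul_pow, euler_mul_eulerInv, one_pow]
  set A := section3 (pentagonalSeries ℤ ^ 3) with hA
  set e := pentagonalSeries ℤ with he
  have h : quotNine ^ 2 = expand3 ((expand3 e ^ 6 * eulerInv ^ 24) *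
        (6 * X * A ^ 3 * expand3 e ^ 9 + 81 * X ^ 2 * expand3 e ^ 18)) +
      expand3 ((expand3 e ^ 6 * eulerInv ^ 24) * 27 * A ^ 2 * X * expand3 e ^ 12) * X +
      expand3 ((expand3 e ^ 6 * eulerInv ^ 24) *
        (A ^ 4 * expand3 e ^ 6 + 54 * A * X * expand3 e ^ 15)) * X ^ 2 := by
    rw [quotNine, eulerInv_pow_three]
    simp only [map_mul, map_pow, expand3_X, map_ofNat, map_add]
    ring
  rw [h, section3_linear_comb, quotThree]
  linear_combination (6 * X * expand3 e ^ 12 * eulerInv ^ 24) * hc +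
    (6 * X * expand3 e ^ 12 * eulerInv ^ 12) * hi

/-! ### Action of the trisection on powers of ζ and polynomials in Z -/

/-- Polynomials expressing the 3-sections of the powers of `3 * quotNine` in `27 * quotThree`. -/
noncomputable def sectionPoly : ℕ → Polynomial ℤ
  | 0 => 1
  | 1 => Polynomial.X
  | 2 => 2 * Polynomial.X + 3 * Polynomial.X ^ 2
  | n + 3 => Polynomial.X * (sectionPoly n + 3 * sectionPoly (n + 1) + 3 * sectionPoly (n + 2))

theorem section3_pow_eq_aeval (i : ℕ) : section3 ((3 * quotNine) ^ i) =
    Polynomial.aeval (27 * quotThree) (sectionPoly i) := by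
  have hsmul : ∀ (m : ℤ) (f : ℤ⟦X⟧), section3 ((m : ℤ⟦X⟧) * f) = (m : ℤ⟦X⟧) * section3 f := by
    intro m f
    rw [← section3_expand3_mul, map_intCast]
  induction i using Nat.strong_induction_on with
  | _ i ih =>
    match i, ih with
    | 0, _ => simp [sectionPoly, section3_one]
    | 1, _ =>
      have := hsmul 3 quotNine
      push_cast at this
      rw [pow_one, this, section3_quotNine, sectionPoly, Polynomial.aeval_X]
      ring
    | 2, _ =>
      have := hsmul 9 (quotNine ^ 2)
      push_cast at this
      rw [mul_pow, show (3 : ℤ⟦X⟧) ^ 2 = 9 by norm_num, this, section3_quotNine_sq, sectionPoly]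
      simp only [map_add, map_mul, map_pow, Polynomial.aeval_X, map_ofNat]
      ring
    | n + 3, ih =>
      have h : (3 * quotNine) ^ (n + 3) = expand3 (27 * quotThree) * ((3 * quotNine) ^ n +
          (3 : ℤ) * (3 * quotNine) ^ (n + 1) + (3 : ℤ) * (3 * quotNine) ^ (n + 2)) := by
        rw [map_mul, map_ofNat]
        push_cast
        linear_combination (27 * (3 * quotNine) ^ n) * quotNine_pow_three
      rw [h, section3_expand3_mul, map_add, map_add, hsmul, hsmul, ih n (by omega),
        ih (n + 1) (by omega), ih (n + 2) (by omega), sectionPoly]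
      simp only [map_add, map_mul, Polynomial.aeval_X, map_ofNat]
      push_cast
      ring

/-- Each use of the cubic equation lowers the power of ζ by at most 3 and contributes one factor Z,
so the order is at least ⌈i/3⌉. -/
theorem X_pow_dvd_sectionPoly (i : ℕ) : Polynomial.X ^ ((i + 2) / 3) ∣ sectionPoly i := by
  induction i using Nat.strong_induction_on with
  | _ i ih =>
    match i, ih with
    | 0, _ => simp
    | 1, _ => simp [sectionPoly]
    | 2, _ => exact ⟨2 + 3 * Polynomial.X, by rw [sectionPoly]; ring⟩
    | n + 3, ih =>
      rw [show (n + 3 + 2) / 3 = (n + 2) / 3 + 1 by omega, pow_succ', sectionPoly]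
      have hd : ∀ j, n ≤ j → j < n + 3 →
          (Polynomial.X : Polynomial ℤ) ^ ((n + 2) / 3) ∣ sectionPoly j := fun j h1 h2 =>
        (pow_dvd_pow _ (by omega)).trans (ih j h2)
      exact mul_dvd_mul_left _ (dvd_add (dvd_add (hd n (by omega) (by omega))
        ((hd (n + 1) (by omega) (by omega)).mul_left _))
        ((hd (n + 2) (by omega) (by omega)).mul_left _))

/-- The series `quotThree * P(27 * quotThree)`. -/
noncomputable def quotPoly (P : Polynomial ℤ) : ℤ⟦X⟧ :=
  quotThree * Polynomial.aeval (27 * quotThree) P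

theorem quotThree_ne_zero : quotThree ≠ 0 := by
  have h : quotThree * expand3 eulerInv ^ 12 * pentagonalSeries ℤ ^ 12 = X := by
    have h1 : expand3 (pentagonalSeries ℤ) ^ 12 * expand3 eulerInv ^ 12 = 1 := by
      rw [← mul_pow, expand3_euler_mul_eulerInv, one_pow]
    have h2 : pentagonalSeries ℤ ^ 12 * eulerInv ^ 12 = 1 := by
      rw [← mul_pow, euler_mul_eulerInv, one_pow]
    rw [quotThree]
    linear_combination X * h1 * pentagonalSeries ℤ ^ 12 * eulerInv ^ 12 + X * h2
  intro h0
  rw [h0, zero_mul, zero_mul] at h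
  exact X_ne_zero h.symm

theorem powerSeries_intCast_ne_zero {m : ℤ} (hm : m ≠ 0) : (m : ℤ⟦X⟧) ≠ 0 := fun h =>
  hm (by simpa using congrArg (constantCoeff (R := ℤ)) h)

/-- Since 27Z · 27Z(q^3) = 9 (3ζ)^4, powers of Z trade for powers of ζ: (27Z)^(j+1) = 9^(j+1)
(3ζ)^(4j+4) / (27Z(q^3))^(j+1). The denominator leaves U as (27Z)^(j+1), while U((3ζ)^(4j+4+r)) is
divisible by (27Z)^(j+2). The 9^(j+1) supplies the factor 9. -/
theorem section3_monomial_mul (j r : ℕ) (hr : r ≤ 1) : ∃ Q : Polynomial ℤ,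
    section3 (quotThree * (27 * quotThree) ^ j * (3 * quotNine) ^ r) = 9 * quotPoly Q := by
  have hdvd : (Polynomial.X : Polynomial ℤ) ^ (j + 2) ∣ sectionPoly (4 * j + 4 + r) :=
    (pow_dvd_pow _ (by omega)).trans (X_pow_dvd_sectionPoly _)
  obtain ⟨s, hs⟩ := hdvd
  refine ⟨9 ^ j * s, ?_⟩
  have h27 : (27 : ℤ⟦X⟧) ≠ 0 := powerSeries_intCast_ne_zero (m := 27) (by norm_num)
  have hz : (27 * quotThree) ^ (j + 1) ≠ 0 :=
    pow_ne_zero _ (mul_ne_zero h27 quotThree_ne_zero)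
  refine mul_left_cancel₀ hz (mul_left_cancel₀ h27 ?_)
  have h1 : (27 : ℤ⟦X⟧) * ((27 * quotThree) ^ (j + 1) *
      section3 (quotThree * (27 * quotThree) ^ j * (3 * quotNine) ^ r)) =
      section3 (expand3 (9 ^ (j + 1)) * (3 * quotNine) ^ (4 * j + 4 + r)) := by
    have h2 : expand3 (9 ^ (j + 1)) * (3 * quotNine) ^ (4 * j + 4 + r) =
        expand3 (27 * (27 * quotThree) ^ (j + 1)) *
          (quotThree * (27 * quotThree) ^ j * (3 * quotNine) ^ r) := by
      have h3 : (9 : ℤ⟦X⟧) ^ (j + 1) * (3 * quotNine) ^ (4 * (j + 1)) =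
          expand3 (27 * quotThree) ^ (j + 1) * (27 * quotThree) ^ (j + 1) := by
        rw [pow_mul, ← mul_pow, ← mul_pow]
        congr 1
        rw [map_mul, map_ofNat]
        linear_combination -729 * quotThree_mul_expand3
      simp only [map_mul, map_pow, map_ofNat] at h3 ⊢
      rw [pow_add _ (4 * j + 4) r, show 4 * j + 4 = 4 * (j + 1) by ring, ← mul_assoc, h3]
      ring
    rw [h2, section3_expand3_mul]
    ring
  rw [h1, section3_expand3_mul, section3_pow_eq_aeval, hs, quotPoly]
  simp only [map_mul, map_pow, map_ofNat, Polynomial.aeval_X]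
  ring

theorem section3_quotPoly_mul (P : Polynomial ℤ) (r : ℕ) (hr : r ≤ 1) : ∃ Q : Polynomial ℤ,
    section3 (quotPoly P * (3 * quotNine) ^ r) = 9 * quotPoly Q := by
  induction P using Polynomial.induction_on' with
  | add p q hp hq =>
    obtain ⟨a, ha⟩ := hp
    obtain ⟨b, hb⟩ := hq
    refine ⟨a + b, ?_⟩
    have h : ∀ p q, quotPoly (p + q) = quotPoly p + quotPoly q := fun p q => by
      simp [quotPoly, mul_add]
    rw [h, h, add_mul, map_add, ha, hb, mul_add]
  | monomial n c =>
    obtain ⟨a, ha⟩ := section3_monomial_mul n r hr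
    refine ⟨Polynomial.C c * a, ?_⟩
    have h1 : quotPoly (Polynomial.monomial n c) * (3 * quotNine) ^ r =
        expand3 (C c) * (quotThree * (27 * quotThree) ^ n * (3 * quotNine) ^ r) := by
      simp [quotPoly, Polynomial.aeval_monomial]
      ring
    rw [h1, section3_expand3_mul, ha]
    simp [quotPoly]
    ring

theorem section3_quotPoly (P : Polynomial ℤ) : ∃ Q, section3 (quotPoly P) = 9 * quotPoly Q := by
  simpa using section3_quotPoly_mul P 0 zero_le_one

theorem section3_quotPoly_mul_quotNine (P : Polynomial ℤ) :
    ∃ Q, section3 (quotPoly P * quotNine) = 3 * quotPoly Q := by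
  obtain ⟨Q, hQ⟩ := section3_quotPoly_mul P 1 le_rfl
  refine ⟨Q, mul_left_cancel₀ (powerSeries_intCast_ne_zero (m := 3) (by norm_num)) ?_⟩
  have h : section3 (expand3 3 * (quotPoly P * quotNine)) =
      3 * section3 (quotPoly P * quotNine) := section3_expand3_mul _ _
  push_cast
  rw [← h, map_ofNat, show (3 : ℤ⟦X⟧) * (quotPoly P * quotNine) =
    quotPoly P * (3 * quotNine) ^ 1 by ring, hQ]
  ring

/-! ### Extracting residue classes -/

theorem section3_X_mul_mk (a : ℕ → ℤ) :
    section3 (X * PowerSeries.mk a) = X * PowerSeries.mk fun n => a (3 * n + 2) := by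
  ext n
  rw [coeff_section3]
  rcases n with _ | n
  · simp
  · rw [show 3 * (n + 1) = 3 * n + 2 + 1 by ring, coeff_succ_X_mul, coeff_succ_X_mul, coeff_mk,
      coeff_mk]

theorem section3_X_sq_mul_mk (a : ℕ → ℤ) :
    section3 (X * (X * PowerSeries.mk a)) = X * PowerSeries.mk fun n => a (3 * n + 1) := by
  ext n
  rw [coeff_section3]
  rcases n with _ | n
  · simp
  · rw [show 3 * (n + 1) = 3 * n + 1 + 1 + 1 by ring, coeff_succ_X_mul, coeff_succ_X_mul,
      coeff_succ_X_mul, coeff_mk, coeff_mk]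

theorem euler_pow_three_mul_eulerInv : pentagonalSeries ℤ ^ 3 * eulerInv ^ 3 = 1 := by
  rw [← mul_pow, euler_mul_eulerInv, one_pow]

theorem expand3_euler_pow_three_mul_eulerInv :
    expand3 (pentagonalSeries ℤ) ^ 3 * expand3 eulerInv ^ 3 = 1 := by
  rw [← mul_pow, expand3_euler_mul_eulerInv, one_pow]

/-- Multiplying by q E(q^9)^3 turns 1/E^3 into ζ, and E(q^9)^3 leaves U as E(q^3)^3. The denominator
thus changes from E^3 to E(q^3)^3; `section_two_of_eq` changes it back. -/
theorem section_one_of_eq {a : ℕ → ℤ} {g f : ℤ⟦X⟧}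
    (h : X * PowerSeries.mk a = expand3 g * f * eulerInv ^ 3) :
    (X * PowerSeries.mk fun n => a (3 * n + 1)) * expand3 (pentagonalSeries ℤ) ^ 3 =
      g * section3 (f * quotNine) := by
  have h1 : expand3 (expand3 (pentagonalSeries ℤ) ^ 3) * (X * (X * PowerSeries.mk a)) =
      expand3 g * (f * quotNine) := by
    rw [h, quotNine, map_pow]
    ring
  have h2 := congrArg section3 h1
  rw [section3_expand3_mul, section3_expand3_mul, section3_X_sq_mul_mk] at h2
  rw [← h2]
  ring

theorem section_two_of_eq {a : ℕ → ℤ} {g f : ℤ⟦X⟧}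
    (h : (X * PowerSeries.mk a) * expand3 (pentagonalSeries ℤ) ^ 3 = expand3 g * f) :
    (X * PowerSeries.mk fun n => a (3 * n + 2)) = g * section3 f * eulerInv ^ 3 := by
  have h1 : expand3 (pentagonalSeries ℤ ^ 3) * (X * PowerSeries.mk a) = expand3 g * f := by
    rw [← h, map_pow]
    ring
  have h2 := congrArg section3 h1
  rw [section3_expand3_mul, section3_expand3_mul, section3_X_mul_mk] at h2
  rw [← h2]
  linear_combination (-(X * PowerSeries.mk fun n => a (3 * n + 2))) * euler_pow_three_mul_eulerInv

theorem section3_pow_mul (c : ℕ) (f : ℤ⟦X⟧) : section3 (3 ^ c * f) = 3 ^ c * section3 f := by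
  rw [← section3_expand3_mul, map_pow, map_ofNat]

/-- The factor `r` is inert. A round takes residue 1 (gain 3), then residue 2 (gain 9): 3(3n + 2) +
1 = 9n + 7 adds 7·9^(j+1) to the remainder. -/
theorem exists_section_eulerInv_pow (j : ℕ) (r : ℤ⟦X⟧) (a : ℕ → ℤ)
    (h : PowerSeries.mk a = expand3^[2 * j + 2] r * eulerInv ^ 3) (s : ℕ)
    (hs : 8 * s = 7 * 9 ^ (j + 1) + 1) : ∃ P,
    (X * PowerSeries.mk fun n => a (9 ^ (j + 1) * n + s)) =
      r * (3 ^ (3 * j + 4) * quotPoly P) * eulerInv ^ 3 := by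
  induction j generalizing r s with
  | zero =>
    obtain rfl : s = 8 := by omega
    have h' : PowerSeries.mk a = expand3 (expand3 r) * eulerInv ^ 3 := h
    -- The generating function has no leading X yet, so the factor X in ζ makes the first section
    -- fall on residue 2.
    have h1 : expand3 (expand3 (pentagonalSeries ℤ) ^ 3) * (X * PowerSeries.mk a) =
        expand3 (expand3 r) * quotNine := by
      rw [h', quotNine, map_pow]
      ring
    have h2 := congrArg section3 h1
    rw [section3_expand3_mul, section3_expand3_mul, section3_X_mul_mk, mul_comm] at h2
    have h3 := section_two_of_eq h2
    obtain ⟨Q, hQ⟩ := section3_quotPoly 1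
    refine ⟨Q, ?_⟩
    have h4 : section3 (section3 quotNine) = 3 ^ 4 * quotPoly Q := by
      have h5 : section3 quotNine = 3 ^ 2 * quotPoly 1 := by
        rw [section3_quotNine, quotPoly, map_one]
        ring
      rw [h5, section3_pow_mul, hQ]
      ring
    rw [h4] at h3
    simpa only [show ∀ n, 3 * (3 * n + 2) + 2 = 9 ^ (0 + 1) * n + 8 from fun n => by ring]
      using h3
  | succ j ih =>
    obtain ⟨s', hs'⟩ : ∃ s', 8 * s' = 7 * 9 ^ (j + 1) + 1 := by
      rw [pow_succ] at hs
      exact ⟨s - 7 * 9 ^ (j + 1), by rw [pow_succ]; omega⟩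
    have hss : s = 9 ^ (j + 1) * 7 + s' := by
      rw [pow_succ] at hs
      omega
    obtain ⟨P, hP⟩ := ih (expand3 (expand3 r)) h s' hs'
    have h1 := section_one_of_eq hP
    rw [mul_assoc (3 ^ (3 * j + 4)), section3_pow_mul] at h1
    obtain ⟨P1, hP1⟩ := section3_quotPoly_mul_quotNine P
    rw [hP1] at h1
    have h2 := section_two_of_eq h1
    obtain ⟨P2, hP2⟩ := section3_quotPoly P1
    refine ⟨P2, ?_⟩
    rw [show (3 : ℤ⟦X⟧) ^ (3 * j + 4) * (3 * quotPoly P1) = 3 ^ (3 * j + 5) * quotPoly P1 by ring,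
      section3_pow_mul, hP2] at h2
    rw [show (3 : ℤ⟦X⟧) ^ (3 * (j + 1) + 4) * quotPoly P2 =
      3 ^ (3 * j + 5) * (9 * quotPoly P2) by ring, ← h2, hss]
    congr 2
    funext n
    congr 1
    ring

/-- The order of residues is now 2, then 1: 3(3n + 1) + 2 = 9n + 5, whence t = 5(1 + 9 + ⋯ +
9^(β-1)). -/
theorem exists_section_iterate (β c t : ℕ) (b : ℕ → ℤ) (P : Polynomial ℤ)
    (h : X * PowerSeries.mk b * expand3 (pentagonalSeries ℤ) ^ 3 = 3 ^ c * quotPoly P)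
    (ht : 8 * t + 5 = 5 * 9 ^ β) : ∃ Q,
    (X * PowerSeries.mk fun n => b (9 ^ β * n + t)) * expand3 (pentagonalSeries ℤ) ^ 3 =
      3 ^ (c + 3 * β) * quotPoly Q := by
  induction β generalizing t with
  | zero =>
    obtain rfl : t = 0 := by omega
    exact ⟨P, by simpa using h⟩
  | succ β ih =>
    obtain ⟨t', ht'⟩ : ∃ t', 8 * t' + 5 = 5 * 9 ^ β := by
      rw [pow_succ] at ht
      exact ⟨t - 5 * 9 ^ β, by omega⟩
    have htt : t = 9 ^ β * 5 + t' := by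
      rw [pow_succ] at ht
      omega
    obtain ⟨Q, hQ⟩ := ih t' ht'
    rw [← one_mul (3 ^ _ * quotPoly Q), ← map_one expand3] at hQ
    have h1 := section_two_of_eq hQ
    obtain ⟨Q1, hQ1⟩ := section3_quotPoly Q
    obtain ⟨Q2, hQ2⟩ := section3_quotPoly_mul_quotNine Q1
    rw [section3_pow_mul, hQ1, ← map_one expand3, show (3 : ℤ⟦X⟧) ^ (c + 3 * β) *
      (9 * quotPoly Q1) = 3 ^ (c + 3 * β + 2) * quotPoly Q1 by ring] at h1
    have h2 := section_one_of_eq h1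
    rw [mul_assoc (3 ^ _), section3_pow_mul, hQ2, one_mul] at h2
    refine ⟨Q2, ?_⟩
    rw [show (3 : ℤ⟦X⟧) ^ (c + 3 * (β + 1)) * quotPoly Q2 =
      3 ^ (c + 3 * β + 2) * (3 * quotPoly Q2) by ring, ← h2, htt]
    congr 3
    funext n
    congr 1
    ring

theorem pow_dvd_of_X_mul_mk_eq {b : ℕ → ℤ} {c : ℕ} {f : ℤ⟦X⟧}
    (h : X * PowerSeries.mk b = 3 ^ c * f) (n : ℕ) : (3 : ℤ) ^ c ∣ b n := by
  refine ⟨coeff (n + 1) f, ?_⟩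
  have h1 := congrArg (coeff (n + 1)) h
  rwa [coeff_succ_X_mul, coeff_mk, show (3 : ℤ⟦X⟧) ^ c = C (3 ^ c) by simp, coeff_C_mul] at h1

/-- In the dissection of 1/E^3 only the x^2 term lacks a factor 3; take fourth powers. -/
theorem eulerInv_pow_twelve_modEq : ∃ f g : ℤ⟦X⟧, eulerInv ^ 12 = expand3 f + 3 * g := by
  have h := eulerInv_pow_three
  obtain ⟨u, hu⟩ : ∃ u, u = X * expand3 (expand3 (pentagonalSeries ℤ)) ^ 3 := ⟨_, rfl⟩
  rw [← hu] at h
  set x := section3 (pentagonalSeries ℤ ^ 3)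
  set y := expand3 (pentagonalSeries ℤ) ^ 3 * eulerInv ^ 12
  have h3 : eulerInv ^ 3 = expand3 (y * x ^ 2) + 3 * (expand3 y * (expand3 x * u + 3 * u ^ 2)) := by
    rw [h, map_mul expand3 y, map_pow expand3 x]
    ring
  generalize expand3 y * (expand3 x * u + 3 * u ^ 2) = v at h3
  refine ⟨(y * x ^ 2) ^ 4, v * (4 * expand3 (y * x ^ 2) ^ 3 + 18 * expand3 (y * x ^ 2) ^ 2 * v +
    36 * expand3 (y * x ^ 2) * v ^ 2 + 27 * v ^ 3), ?_⟩
  rw [show 12 = 3 * 4 by norm_num, pow_mul, h3, map_pow]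
  ring

theorem pow_succ_dvd_of_quotPoly {b : ℕ → ℤ} {c : ℕ} {P : Polynomial ℤ}
    (h : X * PowerSeries.mk b * expand3 (pentagonalSeries ℤ) ^ 3 = 3 ^ c * quotPoly P) (n : ℕ) :
    (3 : ℤ) ^ (c + 1) ∣ b (3 * n + 1) := by
  -- Modulo 3, P(27Z) is constant and Z/X is a series in X^3, so the coefficients at 3n + 1 gain a
  -- factor 3.
  obtain ⟨p0, q, hq⟩ : ∃ (p0 : ℤ) (q : ℤ⟦X⟧),
      Polynomial.aeval (27 * quotThree) P = expand3 (C p0) + 3 * q := by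
    refine ⟨P.coeff 0, 9 * quotThree * Polynomial.aeval (27 * quotThree) P.divX, ?_⟩
    conv_lhs => rw [← Polynomial.divX_mul_X_add P]
    simp
    ring
  obtain ⟨f, g, hfg⟩ := eulerInv_pow_twelve_modEq
  have h1 : PowerSeries.mk b = 3 ^ c * (expand3 (pentagonalSeries ℤ ^ 9 * f * C p0) +
      3 * (expand3 (pentagonalSeries ℤ) ^ 9 * (expand3 f * q + g * expand3 (C p0) + 3 * g * q))) := by
    refine mul_left_cancel₀ (X_ne_zero (R := ℤ)) ?_
    refine Eq.trans (b := X * PowerSeries.mk b * expand3 (pentagonalSeries ℤ) ^ 3 *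
      expand3 eulerInv ^ 3) ?_ ?_
    · rw [mul_assoc (X * PowerSeries.mk b), expand3_euler_pow_three_mul_eulerInv, mul_one]
    · rw [h, quotPoly, hq, quotThree, hfg]
      simp only [map_mul, map_pow]
      linear_combination (3 ^ c * X * expand3 (pentagonalSeries ℤ) ^ 9 * (expand3 f + 3 * g) *
        (expand3 (C p0) + 3 * q)) * expand3_euler_pow_three_mul_eulerInv
  have h2 := congrArg (coeff (3 * n + 1)) h1
  rw [coeff_mk, show (3 : ℤ⟦X⟧) ^ c = C (3 ^ c) by simp, coeff_C_mul, map_add,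
    coeff_expand3_of_not_dvd (by omega), zero_add, show (3 : ℤ⟦X⟧) = C 3 by simp, coeff_C_mul,
    ← mul_assoc, ← pow_succ] at h2
  exact ⟨_, h2⟩

/-! ### The generating function of the triples and the congruences -/

theorem expand_three_pow (k : ℕ) (f : ℤ⟦X⟧) :
    PowerSeries.expand (3 ^ k) (pow_ne_zero k three_ne_zero) f = expand3^[k] f := by
  induction k generalizing f with
  | zero => exact PowerSeries.expand_one_apply f
  | succ k ih =>
    rw [Function.iterate_succ_apply, ← ih]
    exact PowerSeries.expand_mul (3 ^ k) (pow_ne_zero k three_ne_zero) 3 three_ne_zero f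

theorem isPMThreePow_iff (k p : ℕ) : IsPMThreePow k p ↔ 3 ^ k ∣ p ∧ ¬ 3 ^ (k + 1) ∣ p := by
  have hpos : 0 < 3 ^ k := by positivity
  constructor
  · have key : ∀ u c : ℤ, (u = 1 ∨ u = -1) → 3 ^ k * u - (p : ℤ) = 3 ^ (k + 1) * c →
        3 ^ k ∣ p ∧ ¬ 3 ^ (k + 1) ∣ p := by
      intro u c hu h
      have hp : (p : ℤ) = 3 ^ k * (u - 3 * c) := by rw [pow_succ] at h; linarith
      have hd : ((3 ^ k : ℕ) : ℤ) ∣ (p : ℤ) := ⟨_, by rw [hp]; push_cast; rfl⟩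
      refine ⟨Int.natCast_dvd_natCast.1 hd, fun ⟨d, hd⟩ => ?_⟩
      have h1 : (3 : ℤ) ^ k * (u - 3 * c) = 3 ^ k * (3 * d) := by
        rw [← hp, hd]
        push_cast
        ring
      have h2 := mul_left_cancel₀ (by positivity : (3 : ℤ) ^ k ≠ 0) h1
      omega
    rintro (h | h)
    · obtain ⟨c, hc⟩ := Int.modEq_iff_dvd.1 h
      exact key 1 c (Or.inl rfl) (by rw [mul_one]; exact hc)
    · obtain ⟨c, hc⟩ := Int.modEq_iff_dvd.1 h
      exact key (-1) c (Or.inr rfl) (by rw [mul_neg, mul_one]; exact hc)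
  · rintro ⟨⟨m, rfl⟩, h⟩
    have h3 : ¬ 3 ∣ m := fun h3 => h (by rw [pow_succ]; exact mul_dvd_mul_left _ h3)
    obtain ⟨c, hc | hc⟩ : ∃ c, m = 3 * c + 1 ∨ m = 3 * c + 2 := ⟨m / 3, by omega⟩
    · refine Or.inl (Int.modEq_iff_dvd.2 ⟨-c, ?_⟩)
      rw [hc]
      push_cast
      ring
    · refine Or.inr (Int.modEq_iff_dvd.2 ⟨-c - 1, ?_⟩)
      rw [hc]
      push_cast
      ring

theorem mk_tripleCount (k : ℕ) : PowerSeries.mk (fun n => (tripleCount k n : ℤ)) =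
    PowerSeries.mk (fun n =>
      ((Nat.Partition.restricted n fun p => ¬ IsPMThreePow k p).card : ℤ)) ^ 3 := by
  ext n
  set F := PowerSeries.mk (fun n =>
    ((Nat.Partition.restricted n fun p => ¬ IsPMThreePow k p).card : ℤ)) with hF
  have h : F ^ 3 = ∏ _i : Fin 3, F := by simp
  rw [h, coeff_prod, coeff_mk, tripleCount, partitionTriplesAvoiding, Finset.card_sigma]
  push_cast
  refine Finset.sum_nbij' (fun m => Finsupp.equivFunOnFinite.symm m) (fun m => ⇑m) ?_ ?_ ?_ ?_ ?_
  · intro m hm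
    simpa [Finset.mem_finsuppAntidiag, Finset.mem_piAntidiag] using hm
  · intro m hm
    simpa [Finset.mem_finsuppAntidiag, Finset.mem_piAntidiag] using hm
  · intro m _
    rfl
  · intro m _
    exact Finsupp.ext fun _ => rfl
  · intro m _
    simp [hF, Fintype.card_piFinset]

theorem mk_tripleCount_eq (k : ℕ) : PowerSeries.mk (fun n => (tripleCount k n : ℤ)) =
    expand3^[k] (pentagonalSeries ℤ ^ 3 * expand3 eulerInv ^ 3) * eulerInv ^ 3 := by
  have h := mk_card_restricted_mul_euler (pow_ne_zero k three_ne_zero)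
    (pow_ne_zero (k + 1) three_ne_zero) (IsPMThreePow k) (isPMThreePow_iff k)
    (pow_dvd_pow 3 k.le_succ)
  rw [expand_three_pow, expand_three_pow, Function.iterate_succ_apply] at h
  rw [mk_tripleCount]
  generalize PowerSeries.mk _ = F at h ⊢
  have hm : ∀ (k : ℕ) (f g : ℤ⟦X⟧), expand3^[k] (f ^ 3 * g ^ 3) =
      expand3^[k] f ^ 3 * expand3^[k] g ^ 3 := by
    intro k
    induction k with
    | zero => intro f g; rfl
    | succ k ih =>
      intro f g
      simp only [Function.iterate_succ_apply, map_mul, map_pow, ih]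
  have h1 : expand3^[k] (expand3 (pentagonalSeries ℤ)) ^ 3 * expand3^[k] (expand3 eulerInv) ^ 3 =
      1 := by
    rw [← hm, expand3_euler_pow_three_mul_eulerInv]
    exact iterate_map_one expand3 k
  rw [hm, ← h]
  linear_combination (-F ^ 3) * euler_pow_three_mul_eulerInv -
    F ^ 3 * pentagonalSeries ℤ ^ 3 * eulerInv ^ 3 * h1

theorem exists_section_tripleCount (α β t : ℕ)
    (ht : 8 * t = 5 * 9 ^ (α + β + 1) + 2 * 9 ^ (α + 1) + 1) : ∃ Q,
    (X * PowerSeries.mk fun n => (tripleCount (2 * α + 2) (9 ^ (α + β + 1) * n + t) : ℤ)) *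
      expand3 (pentagonalSeries ℤ) ^ 3 = 3 ^ (3 * α + 3 * β + 4) * quotPoly Q := by
  have hmod : ∀ m : ℕ, 9 ^ m % 8 = 1 := fun m => by rw [Nat.pow_mod]; norm_num
  obtain ⟨s, hs⟩ : ∃ s, 8 * s = 7 * 9 ^ (α + 1) + 1 :=
    ⟨(7 * 9 ^ (α + 1) + 1) / 8, by have := hmod (α + 1); omega⟩
  obtain ⟨u, hu⟩ : ∃ u, 8 * u + 5 = 5 * 9 ^ β :=
    ⟨(5 * 9 ^ β - 5) / 8, by have := hmod β; omega⟩
  have htu : t = 9 ^ (α + 1) * u + s := by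
    have h9 : 9 ^ (α + β + 1) = 9 ^ (α + 1) * 9 ^ β := by ring
    have h8 : 8 * (9 ^ (α + 1) * u) + 5 * 9 ^ (α + 1) = 5 * 9 ^ (α + β + 1) := by
      rw [h9]
      linear_combination 9 ^ (α + 1) * hu
    omega
  -- Here r = E^3/E(q^3)^3, so after 2α + 2 sections r/E^3 = 1/E(q^3)^3, the form needed for the
  -- iteration in β.
  obtain ⟨P, hP⟩ := exists_section_eulerInv_pow α _ _ (mk_tripleCount_eq (2 * α + 2)) s hs
  have h1 : (X * PowerSeries.mk fun n => (tripleCount (2 * α + 2) (9 ^ (α + 1) * n + s) : ℤ)) *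
      expand3 (pentagonalSeries ℤ) ^ 3 = 3 ^ (3 * α + 4) * quotPoly P := by
    rw [hP]
    linear_combination (3 ^ (3 * α + 4) * quotPoly P) * (expand3 (pentagonalSeries ℤ) ^ 3 *
      expand3 eulerInv ^ 3 * euler_pow_three_mul_eulerInv + expand3_euler_pow_three_mul_eulerInv)
  obtain ⟨Q, hQ⟩ := exists_section_iterate β _ u _ P h1 hu
  refine ⟨Q, ?_⟩
  rw [show 3 * α + 3 * β + 4 = 3 * α + 4 + 3 * β by ring, ← hQ, htu]
  congr 3
  funext n
  congr 2
  ring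

theorem theorem1p4 (n α β : ℕ) :
    tripleCount (2 * α + 2)
        (3 ^ (2 * α + 2 * β + 2) * n
          + (5 * 3 ^ (2 * α + 2 * β + 2) + 2 * 3 ^ (2 * α + 2) + 1) / 8)
      ≡ 0 [MOD 3 ^ (3 * α + 3 * β + 4)] ∧
    tripleCount (2 * α + 2)
        (3 ^ (2 * α + 2 * β + 3) * n
          + (13 * 3 ^ (2 * α + 2 * β + 2) + 2 * 3 ^ (2 * α + 2) + 1) / 8)
      ≡ 0 [MOD 3 ^ (3 * α + 3 * β + 5)] ∧
    tripleCount (2 * α + 2)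
        (3 ^ (2 * α + 2 * β + 3) * n
          + (7 * 3 ^ (2 * α + 2 * β + 3) + 2 * 3 ^ (2 * α + 2) + 1) / 8)
      ≡ 0 [MOD 3 ^ (3 * α + 3 * β + 6)] := by
  have hmod : ∀ m : ℕ, 9 ^ m % 8 = 1 := fun m => by rw [Nat.pow_mod]; norm_num
  have e1 : 3 ^ (2 * α + 2 * β + 2) = 9 ^ (α + β + 1) := by
    rw [show 2 * α + 2 * β + 2 = 2 * (α + β + 1) by ring, pow_mul]
    norm_num
  have e2 : 3 ^ (2 * α + 2) = 9 ^ (α + 1) := by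
    rw [show 2 * α + 2 = 2 * (α + 1) by ring, pow_mul]
    norm_num
  have e3 : 3 ^ (2 * α + 2 * β + 3) = 3 * 9 ^ (α + β + 1) := by rw [pow_succ, e1, mul_comm]
  have m1 := hmod (α + β + 1)
  have m2 := hmod (α + 1)
  obtain ⟨t, ht⟩ : ∃ t, 8 * t = 5 * 9 ^ (α + β + 1) + 2 * 9 ^ (α + 1) + 1 :=
    ⟨(5 * 9 ^ (α + β + 1) + 2 * 9 ^ (α + 1) + 1) / 8, by omega⟩
  obtain ⟨Q, hQ⟩ := exists_section_tripleCount α β t ht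
  have toNat : ∀ c m : ℕ, (3 : ℤ) ^ c ∣ (m : ℤ) → m ≡ 0 [MOD 3 ^ c] := fun c m h =>
    (Nat.modEq_zero_iff_dvd).2 (by exact_mod_cast h)
  rw [e1, e2, e3]
  refine ⟨toNat _ _ ?_, toNat _ _ ?_, toNat _ _ ?_⟩
  · have h1 : X * PowerSeries.mk (fun n =>
        (tripleCount (2 * α + 2) (9 ^ (α + β + 1) * n + t) : ℤ)) =
        3 ^ (3 * α + 3 * β + 4) * (quotPoly Q * expand3 eulerInv ^ 3) := by
      rw [← mul_assoc, ← hQ, mul_assoc _ (expand3 (pentagonalSeries ℤ) ^ 3),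
        expand3_euler_pow_three_mul_eulerInv, mul_one]
    have h2 := pow_dvd_of_X_mul_mk_eq h1 n
    rwa [show (5 * 9 ^ (α + β + 1) + 2 * 9 ^ (α + 1) + 1) / 8 = t by omega]
  -- Index 3n + 1 shifts t by 9^(α+β+1), and 13 = 5 + 8; in the last case 3n + 2 corresponds to 21 =
  -- 5 + 16.
  · have h2 := pow_succ_dvd_of_quotPoly hQ n
    rwa [show 9 ^ (α + β + 1) * (3 * n + 1) + t = 3 * 9 ^ (α + β + 1) * n +
      (13 * 9 ^ (α + β + 1) + 2 * 9 ^ (α + 1) + 1) / 8 by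
        rw [show (13 * 9 ^ (α + β + 1) + 2 * 9 ^ (α + 1) + 1) / 8 = 9 ^ (α + β + 1) + t by omega]
        ring] at h2
  · rw [← one_mul (3 ^ _ * quotPoly Q), ← map_one expand3] at hQ
    have h1 := section_two_of_eq hQ
    obtain ⟨Q1, hQ1⟩ := section3_quotPoly Q
    rw [section3_pow_mul, hQ1, one_mul, show (3 : ℤ⟦X⟧) ^ (3 * α + 3 * β + 4) *
      (9 * quotPoly Q1) * eulerInv ^ 3 =
      3 ^ (3 * α + 3 * β + 6) * (quotPoly Q1 * eulerInv ^ 3) by ring] at h1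
    have h2 := pow_dvd_of_X_mul_mk_eq h1 n
    rwa [show 9 ^ (α + β + 1) * (3 * n + 2) + t = 3 * 9 ^ (α + β + 1) * n +
      (7 * (3 * 9 ^ (α + β + 1)) + 2 * 9 ^ (α + 1) + 1) / 8 by
        rw [show (7 * (3 * 9 ^ (α + β + 1)) + 2 * 9 ^ (α + 1) + 1) / 8 =
          2 * 9 ^ (α + β + 1) + t by omega]
        ring] at h2
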